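/- Let $\mathcal X$ be a Polish space with its Borel $\sigma$-algebra, $\mu$ a Borel probability measure on $\mathcal X$, and $T:\mathcal X\to\mathcal X$ a measurable $\mu$-preserving map whose Koopman operator $Kf=f\circ T$ is unitary on $L^2(\mu)=L^2(\mu;\mathbb C)$ (for instance, $T$ bijective). Write $\langle\cdot,\cdot\rangle$ and $\|\cdot\|$ for the scalar product and norm of $L^2(\mu)$, $\|\cdot\|_F$ for the Frobenius norm, and $Q$ for the orthogonal projection of $L^2(\mu)$ onto the complement of the constants. Let $\psi_1,\dots,\psi_N:\mathcal X\to\mathbb R$ be continuous, such that $\sum_j\lambda_j\psi_j=0$ $\mu$-a.e. with $\lambda\in\mathbb R^N$ implies $\lambda=0$, and such that $\varphi:=\sum_{j=1}^N\psi_j^2\in L^2(\mu)$. Put $$C=(\langle\psi_i,\psi_j\rangle)_{i,j},\qquad C_+=(\langle\psi_i,K\psi_j\rangle)_{i,j},\qquad \psi_{ij}=\psi_i\psi_j,\qquad g_{ij}=\psi_i\cdot K\psi_j,$$ $$\mathbb E_0=\|\varphi\|^2-\|C\|_F^2,\qquad \mathbb E_+=\langle K\varphi,\varphi\rangle-\|C_+\|_F^2,$$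 assume $C_+\neq0$, and let $$M=\frac{8\,(1+\|C^{-1}\|_F^2\|C_+\|_F^2)^2}{\|C_+\|_F^2}\max\{\mathbb E_0,\mathbb E_+\}.$$ Let $x_0$ be a random variable with law $\mu$, let $x_{k+1}=T(x_k)$ almost surely for all $k\ge0$, and for $m\ge1$ put, with $\Psi=(\psi_1,\dots,\psi_N)^\top$, $$\widehat C=\frac1m\sum_{k=0}^{m-1}\Psi(x_k)\Psi(x_k)^\top,\qquad \widehat C_+=\frac1m\sum_{k=0}^{m-1}\Psi(x_k)\Psi(x_{k+1})^\top .$$ For $f\in L^2(\mu)$ let $\mu_f(\Delta)=\|E(\Delta)f\|^2$, where $E$ is the spectral measure of $K$; that is, $\mu_f$ is the finite Borel measure on the unit circle with $\int g\,d\mu_f=\langle g(K)f,f\rangle$ for all continuous $g$. Let $S_\gamma=\{e^{2\pi it}:-\gamma\le t\le\gamma\}$ and $\mathcal F=\{Q\psi_{ij}\}_{i,j}\cup\{Qg_{ij}\}_{i,j}$. Let $\alpha\in(0,2)$, $\kappa\ge0$ and $\theta\in(0,1/2)$ be such that $$\mu_f(S_\gamma)\le\kappa\,\mu_f(S_\theta)\,\gamma^\alpha\qquad\text{for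 all } f\in\mathcal F,\ \gamma\in(0,\theta].$$ Define $$C(\alpha,\kappa,\theta)=\max\Big\{\frac2{1-\cos\theta},\,\kappa\,C(\alpha)\Big\},\qquad C(\alpha)=\begin{cases}\frac{4-3\alpha}{1-\alpha},&\alpha\in(0,1),\\ 3,&\alpha=1,\\ \frac3{(\alpha-1)(2-\alpha)},&\alpha\in(1,2).\end{cases}$$ Then for all $m\ge1$ and all $\varepsilon\in(0,2)$, $$\mathbb P\big(\widehat C\text{ is singular, or }\|C^{-1}C_+-\widehat C^{-1}\widehat C_+\|_F>\varepsilon\big)\le\frac{C(\alpha,\kappa,\theta)\,M}{m^\alpha\varepsilon^2},$$ which is a superlinear rate in $m$ when $\alpha\in(1,2)$. If $\kappa=0$, then the same probability is at most $$\frac{M}{(1-\cos\theta)\,m^2\varepsilon^2}.$$ -/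

import Mathlib

open MeasureTheory ProbabilityTheory Set
open scoped InnerProductSpace CompactlySupported Matrix.Norms.Frobenius

noncomputable section

namespace Edmd

/-! ### Scalar spectral measures of a normal operator -/

section Spectral

variable {H : Type*} [NormedAddCommGroup H] [InnerProductSpace ℂ H] [CompleteSpace H]

open scoped ComplexOrder in
/-- The positive functional `g ↦ ⟨g(U) f, f⟩` on real-valued compactly supported continuous
functions `g` on `ℂ`, where `g(U)` is the continuous functional calculus of the normal operator
`U`. -/
def spectralFunctional (U : H →L[ℂ] H) (hU : IsStarNormal U) (f : H) :
    C_c(ℂ, ℝ) →ₚ[ℝ] ℝ :=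
  PositiveLinearMap.mk₀
    { toFun := fun g => (⟪f, cfc (fun z : ℂ => ((g z : ℝ) : ℂ)) U f⟫_ℂ).re
      map_add' := by
        intro g h
        have hg : Continuous fun z : ℂ => ((g z : ℝ) : ℂ) :=
          Complex.continuous_ofReal.comp g.continuous
        have hh : Continuous fun z : ℂ => ((h z : ℝ) : ℂ) :=
          Complex.continuous_ofReal.comp h.continuous
        have e : cfc (fun z : ℂ => (((g + h) z : ℝ) : ℂ)) U
            = cfc (fun z : ℂ => ((g z : ℝ) : ℂ)) U + cfc (fun z : ℂ => ((h z : ℝ) : ℂ)) U := by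
          rw [← cfc_add (a := U) _ _ hg.continuousOn hh.continuousOn]
          simp
        rw [e, add_apply, inner_add_right, Complex.add_re]
      map_smul' := by
        intro c g
        have hg : Continuous fun z : ℂ => ((g z : ℝ) : ℂ) :=
          Complex.continuous_ofReal.comp g.continuous
        have e : cfc (fun z : ℂ => (((c • g) z : ℝ) : ℂ)) U
            = (c : ℂ) • cfc (fun z : ℂ => ((g z : ℝ) : ℂ)) U := by
          rw [← cfc_const_mul (c : ℂ) _ U hg.continuousOn]
          simp
        rw [e, smul_apply, inner_smul_right, Complex.re_ofReal_mul]
        rfl }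
    (by
      intro g hg
      have h0 : 0 ≤ cfc (fun z : ℂ => ((g z : ℝ) : ℂ)) U := by
        refine cfc_nonneg fun z _ => ?_
        exact Complex.zero_le_real.2 (hg z)
      have h1 := (ContinuousLinearMap.nonneg_iff_isPositive _).1 h0
      exact h1.re_inner_nonneg_right f)

/-- The spectral measure `μ_f` of the vector `f` with respect to the normal operator `U`: the
Borel measure on `ℂ` that represents `g ↦ ⟨g(U) f, f⟩`, that is, `μ_f(Δ) = ‖E(Δ) f‖²` for the
projection-valued spectral measure `E` of `U`. It is carried by the spectrum of `U`, so by the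
unit circle when `U` is unitary. -/
def spectralMeasure (U : H →L[ℂ] H) (hU : IsStarNormal U) (f : H) : Measure ℂ :=
  RealRMK.rieszMeasure (spectralFunctional U hU f)

/-- The defining property `∫ g dμ_f = ⟨g(U) f, f⟩` of the spectral measure. -/
theorem integral_spectralMeasure (U : H →L[ℂ] H) (hU : IsStarNormal U) (f : H)
    (g : C_c(ℂ, ℝ)) :
    ∫ z, g z ∂(spectralMeasure U hU f)
      = (⟪f, cfc (fun z : ℂ => ((g z : ℝ) : ℂ)) U f⟫_ℂ).re :=
  RealRMK.integral_rieszMeasure _ g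

end Spectral

/-- The arc `S_θ = {e^{2πit} : -θ ≤ t ≤ θ}`. -/
def arc (θ : ℝ) : Set ℂ :=
  {z | ∃ t : ℝ, -θ ≤ t ∧ t ≤ θ ∧ z = Complex.exp (2 * Real.pi * Complex.I * t)}

/-! ### The Koopman operator and the dictionary -/

section Koopman

variable {S : Type*} [MeasurableSpace S] {μ : Measure S}

/-- The Koopman operator `K f = f ∘ T` on `L²(μ; ℂ)`. -/
def koopman (T : S → S) (hT : MeasurePreserving T μ μ) : Lp ℂ 2 μ →L[ℂ] Lp ℂ 2 μ :=
  (Lp.compMeasurePreservingₗᵢ ℂ T hT).toContinuousLinearMap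

/-- The constant function `1` as an element of `L²(μ; ℂ)`. -/
def oneL2 (μ : Measure S) [IsProbabilityMeasure μ] : Lp ℂ 2 μ :=
  Lp.const 2 μ (1 : ℂ)

/-- The orthogonal projection `Q` of `L²(μ; ℂ)` onto `L²₀(μ) = (span {1})ᗮ`. -/
def projQ (μ : Measure S) [IsProbabilityMeasure μ] : Lp ℂ 2 μ →L[ℂ] Lp ℂ 2 μ :=
  (Submodule.span ℂ {oneL2 μ})ᗮ.starProjection

variable {N : ℕ}

/-- `φ = ∑ j, ψ_j²`. -/
def phi (ψ : Fin N → S → ℝ) (x : S) : ℝ := ∑ j, ψ j x ^ 2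

theorem memLp_mul_comp {ψ : Fin N → S → ℝ} (hψ : ∀ i, Measurable (ψ i))
    (hφ : MemLp (phi ψ) 2 μ) {T : S → S} (hT : MeasurePreserving T μ μ) (i j : Fin N) :
    MemLp (fun x => ((ψ i x * ψ j (T x) : ℝ) : ℂ)) 2 μ := by
  have h1 : MemLp (fun x => phi ψ x + phi ψ (T x)) 2 μ :=
    hφ.add (hφ.comp_measurePreserving hT)
  have hm : Measurable fun x => ((ψ i x * ψ j (T x) : ℝ) : ℂ) :=
    Complex.measurable_ofReal.comp ((hψ i).mul ((hψ j).comp hT.measurable))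
  refine h1.mono hm.aestronglyMeasurable (Filter.Eventually.of_forall fun x => ?_)
  have hi : ψ i x ^ 2 ≤ phi ψ x :=
    Finset.single_le_sum (f := fun k => ψ k x ^ 2) (fun k _ => sq_nonneg _) (Finset.mem_univ i)
  have hj : ψ j (T x) ^ 2 ≤ phi ψ (T x) :=
    Finset.single_le_sum (f := fun k => ψ k (T x) ^ 2) (fun k _ => sq_nonneg _)
      (Finset.mem_univ j)
  rw [Complex.norm_real, Real.norm_eq_abs, Real.norm_eq_abs]
  refine le_trans ?_ (le_abs_self _)
  rw [abs_le]
  constructor <;> nlinarith [sq_nonneg (ψ i x + ψ j (T x)), sq_nonneg (ψ i x - ψ j (T x)),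
    sq_nonneg (ψ i x), sq_nonneg (ψ j (T x))]

/-- The finite family `𝓕` of all `Q ψ_{ij}` and `Q g_{ij}` in `L²(μ; ℂ)`, where
`ψ_{ij} = ψ_i ψ_j` and `g_{ij} = ψ_i · K ψ_j`. -/
def family [IsProbabilityMeasure μ] (ψ : Fin N → S → ℝ) (hψ : ∀ i, Measurable (ψ i))
    (hφ : MemLp (phi ψ) 2 μ) (T : S → S) (hT : MeasurePreserving T μ μ) :
    Set (Lp ℂ 2 μ) :=
  {f | ∃ i j, f = projQ μ ((memLp_mul_comp hψ hφ (MeasurePreserving.id μ) i j).toLp _)} ∪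
    {f | ∃ i j, f = projQ μ ((memLp_mul_comp hψ hφ hT i j).toLp _)}

/-- `μ`-linear independence. -/
def AELinearIndependent (μ : Measure S) (ψ : Fin N → S → ℝ) : Prop :=
  ∀ c : Fin N → ℝ, (∀ᵐ x ∂μ, ∑ j, c j * ψ j x = 0) → ∀ j, c j = 0

/-- The mass matrix `C = (⟨ψ_i, ψ_j⟩)`. -/
def massMatrix (μ : Measure S) (ψ : Fin N → S → ℝ) : Matrix (Fin N) (Fin N) ℝ :=
  Matrix.of fun i j => ∫ x, ψ i x * ψ j x ∂μ

/-- The stiffness matrix `C₊ = (⟨ψ_i, K ψ_j⟩)`, with `K ψ_j = ψ_j ∘ T`. -/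
def stiffMatrix (μ : Measure S) (T : S → S) (ψ : Fin N → S → ℝ) : Matrix (Fin N) (Fin N) ℝ :=
  Matrix.of fun i j => ∫ x, ψ i x * ψ j (T x) ∂μ

/-- `𝔼₀ = ‖φ‖² - ‖C‖_F²`. -/
def energyZero (μ : Measure S) (ψ : Fin N → S → ℝ) : ℝ :=
  ∫ x, phi ψ x ^ 2 ∂μ - ‖massMatrix μ ψ‖ ^ 2

/-- `𝔼₊ = ⟨K φ, φ⟩ - ‖C₊‖_F²`. -/
def energyPlus (μ : Measure S) (T : S → S) (ψ : Fin N → S → ℝ) : ℝ :=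
  ∫ x, phi ψ (T x) * phi ψ x ∂μ - ‖stiffMatrix μ T ψ‖ ^ 2

/-- The constant `M = 8 (1 + ‖C⁻¹‖_F² ‖C₊‖_F²)² / ‖C₊‖_F² · max {𝔼₀, 𝔼₊}`. -/
def constM (μ : Measure S) (T : S → S) (ψ : Fin N → S → ℝ) : ℝ :=
  8 * (1 + ‖(massMatrix μ ψ)⁻¹‖ ^ 2 * ‖stiffMatrix μ T ψ‖ ^ 2) ^ 2 / ‖stiffMatrix μ T ψ‖ ^ 2
    * max (energyZero μ ψ) (energyPlus μ T ψ)

/-- The data matrix `[Ψ(x_0), …, Ψ(x_{m-1})]`, where `Ψ = (ψ_1, …, ψ_N)ᵀ`. -/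
def dataMatrix (ψ : Fin N → S → ℝ) (m : ℕ) (x : ℕ → S) : Matrix (Fin N) (Fin m) ℝ :=
  Matrix.of fun i k => ψ i (x k)

/-- The empirical estimator `Ĉ = (1/m) Ψ_X Ψ_Xᵀ` from the trajectory `x`. -/
def empMass (ψ : Fin N → S → ℝ) (m : ℕ) (x : ℕ → S) : Matrix (Fin N) (Fin N) ℝ :=
  (1 / (m : ℝ)) • (dataMatrix ψ m x * (dataMatrix ψ m x).transpose)

/-- The empirical estimator `Ĉ₊ = (1/m) Ψ_X Ψ_Yᵀ` from the trajectory `x`, with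
`y_k = x_{k+1}`. -/
def empStiff (ψ : Fin N → S → ℝ) (m : ℕ) (x : ℕ → S) : Matrix (Fin N) (Fin N) ℝ :=
  (1 / (m : ℝ)) • (dataMatrix ψ m x * (dataMatrix ψ m fun k => x (k + 1)).transpose)

end Koopman

/-- `C(α)` for `α ∈ (0, 2)`. -/
def constAlpha (α : ℝ) : ℝ :=
  if α < 1 then (4 - 3 * α) / (1 - α)
  else if α = 1 then 3
  else 3 / ((α - 1) * (2 - α))

/-- `C(α, κ, θ) = max {2 / (1 - cos θ), κ C(α)}`. -/
def constC (α κ θ : ℝ) : ℝ := max (2 / (1 - Real.cos θ)) (κ * constAlpha α)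

end Edmd

end

/-!
The proof combines a mean ergodic theorem with rates and a perturbation bound for `C⁻¹ C₊`.

*Ergodic rates.* Put `p(z) = (1/m) ∑_{k<m} z^k`, a polynomial. For a unitary `U` the spectral
measure `μ_f` is finite, is carried by the unit circle, and `‖p(U) f‖² = ∫ |p|² dμ_f`
(`integral_norm_eval_sq_spectralMeasure`). At `z = e^{2πit}` with `|t| ≤ 1/2` the geometric sum
gives `|p(z)| ≤ 1 / (2m|t|)`. Off the arc `S_θ` this is a bound of order `m⁻²` on `|p|²`. On `S_θ`
it says that `{|p|² ≥ s}` is contained in the arc of half-width `1 / (2m√s)`, so that the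
hypothesis `μ_f(S_γ) ≤ κ μ_f(S_θ) γ^α` and the layer-cake formula bound `∫_{S_θ} |p|² dμ_f` by
`κ μ_f(S_θ) (2m)^{-α} ∫_0^1 s^{-α/2} ds`. This yields `norm_average_sq_le`, and, when `κ = 0`,
`norm_average_sq_le_of_gap`.

*Variance.* The entries of `Ĉ - C` and `Ĉ₊ - C₊` along an orbit are the ergodic averages `p(K) f`
of the members `f` of the family `𝓕`. Summing over the entries, the mean-square Frobenius errors
are at most `c 𝔼₀` and `c 𝔼₊`, where `c` is the ergodic rate, and Chebyshev's inequality gives the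
tail bounds (`measureReal_le_norm_timeAverage_sub`).

*Perturbation.* With `x = ‖C⁻¹‖ ‖C₊‖` and `u = ε / (x + ε + 3/2)`, errors below `u / ‖C⁻¹‖` in `C`
and below `3u / (2‖C⁻¹‖)` in `C₊` keep `Ĉ` invertible and the error of `Ĉ⁻¹ Ĉ₊` at most `ε`
(`isUnit_and_norm_inv_mul_sub_le`). The two tail bounds at these thresholds add up to at most
`c M / ε²`, because `(x + ε + 3/2)² (1 + 4/9) x² ≤ 8 (1 + x²)²` for `ε < 2`
(`sq_mul_le_of_lt_two`). Equal thresholds would not suffice when `1 < x < 2` and `ε` is close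
to `2`.
-/

namespace Edmd


/-! ### The spectral measure of a unitary operator -/

section Spectral

variable {H : Type*} [NormedAddCommGroup H] [InnerProductSpace ℂ H] [CompleteSpace H]

/-- A continuous function on `ℂ` is cut off between the discs of radius `n` and `n + 1`, to become a
valid test function in the definition of the spectral measure. -/
theorem exists_compactlySupported_eq_mul_cutoff (h : ℂ → ℝ) (hh : Continuous h) (n : ℕ) :
    ∃ g : C_c(ℂ, ℝ), ∀ z, g z = h z * max 0 (min 1 (n + 1 - ‖z‖)) := by
  refine ⟨⟨⟨fun z => h z * max 0 (min 1 (n + 1 - ‖z‖)), by fun_prop⟩, ?_⟩, fun z => rfl⟩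
  refine HasCompactSupport.of_support_subset_isCompact
    (isCompact_closedBall (0 : ℂ) (n + 1)) fun z hz => ?_
  rw [mem_closedBall_zero_iff]
  by_contra hlt
  push Not at hlt
  refine hz ?_
  have h1 : min 1 ((n : ℝ) + 1 - ‖z‖) ≤ 0 := (min_le_right _ _).trans (by linarith)
  simp [max_eq_left h1]

theorem norm_eq_one_of_mem_spectrum {U : H →L[ℂ] H} (hU : U ∈ unitary (H →L[ℂ] H)) {z : ℂ}
    (hz : z ∈ spectrum ℂ U) : ‖z‖ = 1 := by
  simpa using spectrum.subset_circle_of_unitary hU hz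

/-- The spectral measure of a unitary operator is carried by the unit circle. -/
theorem ae_norm_eq_one_spectralMeasure {U : H →L[ℂ] H} (hU : U ∈ unitary (H →L[ℂ] H)) (f : H) :
    ∀ᵐ z ∂(spectralMeasure U (isStarNormal_of_mem_unitary hU) f), ‖z‖ = 1 := by
  -- the test function `|‖z‖ - 1|`, cut off, vanishes on the spectrum
  have key (n : ℕ) : ∀ᵐ z ∂(spectralMeasure U (isStarNormal_of_mem_unitary hU) f),
      ‖z‖ ≤ n → ‖z‖ = 1 := by
    obtain ⟨g, hg⟩ := exists_compactlySupported_eq_mul_cutoff (fun z => |‖z‖ - 1|)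
      (by fun_prop) n
    have hg0 : 0 ≤ fun z => g z := fun z => by
      simp only [hg]
      exact mul_nonneg (abs_nonneg _) (le_max_left _ _)
    have hreg : (spectralMeasure U (isStarNormal_of_mem_unitary hU) f).Regular :=
      RealRMK.regular_rieszMeasure _
    have hint : Integrable (fun z => g z)
        (spectralMeasure U (isStarNormal_of_mem_unitary hU) f) :=
      g.continuous.integrable_of_hasCompactSupport g.hasCompactSupport
    have h0 : ∫ z, g z ∂(spectralMeasure U (isStarNormal_of_mem_unitary hU) f) = 0 := by
      rw [integral_spectralMeasure]
      have : cfc (fun z : ℂ => ((g z : ℝ) : ℂ)) U = cfc (fun _ : ℂ => (0 : ℂ)) U := by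
        refine cfc_congr fun z hz => ?_
        simp [hg, norm_eq_one_of_mem_spectrum hU hz]
      rw [this, cfc_const_zero]
      simp
    filter_upwards [(integral_eq_zero_iff_of_nonneg hg0 hint).1 h0] with z hz hzn
    have h1 : min 1 ((n : ℝ) + 1 - ‖z‖) = 1 := min_eq_left (by linarith)
    have h2 : |‖z‖ - 1| = 0 := by simpa [hg, h1] using hz
    linarith [abs_eq_zero.1 h2]
  filter_upwards [ae_all_iff.2 key] with z hz
  obtain ⟨n, hn⟩ := exists_nat_ge ‖z‖
  exact hz n hn

theorem isFiniteMeasure_spectralMeasure {U : H →L[ℂ] H} (hU : U ∈ unitary (H →L[ℂ] H)) (f : H) :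
    IsFiniteMeasure (spectralMeasure U (isStarNormal_of_mem_unitary hU) f) := by
  have hreg : (spectralMeasure U (isStarNormal_of_mem_unitary hU) f).Regular :=
    RealRMK.regular_rieszMeasure _
  refine ⟨?_⟩
  have hle : (univ : Set ℂ) ≤ᵐ[spectralMeasure U (isStarNormal_of_mem_unitary hU) f]
      Metric.closedBall (0 : ℂ) 1 := by
    filter_upwards [ae_norm_eq_one_spectralMeasure hU f] with z hz _
    exact mem_closedBall_zero_iff.2 hz.le
  exact (measure_mono_ae hle).trans_lt (isCompact_closedBall (0 : ℂ) 1).measure_lt_top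

/-- The spectral isometry for polynomials: `p ↦ p(U) f` is isometric from `L²(μ_f)` to `H`. -/
theorem integral_norm_eval_sq_spectralMeasure {U : H →L[ℂ] H} (hU : U ∈ unitary (H →L[ℂ] H))
    (f : H) (p : Polynomial ℂ) :
    ∫ z, ‖p.eval z‖ ^ 2 ∂(spectralMeasure U (isStarNormal_of_mem_unitary hU) f)
      = ‖Polynomial.aeval U p f‖ ^ 2 := by
  have hN : IsStarNormal U := isStarNormal_of_mem_unitary hU
  obtain ⟨g, hg⟩ := exists_compactlySupported_eq_mul_cutoff (fun z => ‖p.eval z‖ ^ 2)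
    (by fun_prop) 1
  have hg1 (z : ℂ) (hz : ‖z‖ = 1) : g z = ‖p.eval z‖ ^ 2 := by
    simp [hg, hz]
  have e1 : ∫ z, ‖p.eval z‖ ^ 2 ∂(spectralMeasure U (isStarNormal_of_mem_unitary hU) f)
      = ∫ z, g z ∂(spectralMeasure U (isStarNormal_of_mem_unitary hU) f) := by
    refine integral_congr_ae ?_
    filter_upwards [ae_norm_eq_one_spectralMeasure hU f] with z hz
    exact (hg1 z hz).symm
  have e2 : cfc (fun z : ℂ => ((g z : ℝ) : ℂ)) U
      = star (Polynomial.aeval U p) * Polynomial.aeval U p := by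
    rw [← cfc_polynomial p U, ← cfc_star, ← cfc_mul _ _ U (by fun_prop) (by fun_prop)]
    refine cfc_congr fun z hz => ?_
    simp only [hg1 z (norm_eq_one_of_mem_spectrum hU hz)]
    rw [Complex.star_def, ← Complex.normSq_eq_conj_mul_self, Complex.normSq_eq_norm_sq]
  rw [e1, integral_spectralMeasure, e2, ContinuousLinearMap.star_eq_adjoint,
    show (ContinuousLinearMap.adjoint (Polynomial.aeval U p) * Polynomial.aeval U p) f
      = ContinuousLinearMap.adjoint (Polynomial.aeval U p) (Polynomial.aeval U p f) from rfl,
    ContinuousLinearMap.adjoint_inner_right]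
  exact inner_self_eq_norm_sq (𝕜 := ℂ) _

end Spectral


/-! ### Geometric averages on the unit circle -/

/-- The polynomial `(1/m) ∑_{k<m} z^k`; its value at a unitary `U` is the ergodic average of
`U`. -/
noncomputable def averagePoly (m : ℕ) : Polynomial ℂ :=
  Polynomial.C (1 / (m : ℂ)) * ∑ k ∈ Finset.range m, Polynomial.X ^ k

theorem eval_averagePoly (m : ℕ) (z : ℂ) :
    (averagePoly m).eval z = 1 / (m : ℂ) * ∑ k ∈ Finset.range m, z ^ k := by
  simp [averagePoly, Polynomial.eval_finsetSum]

theorem norm_eval_averagePoly_le_one (m : ℕ) {z : ℂ} (hz : ‖z‖ = 1) :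
    ‖(averagePoly m).eval z‖ ≤ 1 := by
  rw [eval_averagePoly, norm_mul]
  have h1 : ‖∑ k ∈ Finset.range m, z ^ k‖ ≤ m := by
    refine (norm_sum_le _ _).trans ?_
    simp [hz]
  rcases Nat.eq_zero_or_pos m with rfl | hm
  · simp
  have hm' : (0 : ℝ) < m := by exact_mod_cast hm
  calc ‖1 / (m : ℂ)‖ * ‖∑ k ∈ Finset.range m, z ^ k‖ ≤ ‖1 / (m : ℂ)‖ * m := by gcongr
    _ = 1 := by simp [hm'.ne']

theorem norm_eval_averagePoly_mul_le {m : ℕ} (hm : 1 ≤ m) {z : ℂ} (hz : ‖z‖ = 1) :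
    ‖(averagePoly m).eval z‖ * (m * ‖z - 1‖) ≤ 2 := by
  have hm' : (m : ℂ) ≠ 0 := by exact_mod_cast (by omega : m ≠ 0)
  have h1 : (averagePoly m).eval z * (m * (z - 1)) = z ^ m - 1 := by
    rw [eval_averagePoly, ← geom_sum_mul]
    field_simp
  have h2 : ‖(averagePoly m).eval z‖ * (m * ‖z - 1‖) = ‖z ^ m - 1‖ := by
    rw [← h1]
    simp
  rw [h2]
  refine (norm_sub_le _ _).trans ?_
  simp [hz]
  norm_num

theorem four_mul_abs_le_norm_exp_sub_one {t : ℝ} (ht : |t| ≤ 1 / 2) :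
    4 * |t| ≤ ‖Complex.exp (2 * Real.pi * Complex.I * t) - 1‖ := by
  have e : (2 * Real.pi * Complex.I * t : ℂ) = Complex.I * ((2 * Real.pi * t : ℝ) : ℂ) := by
    push_cast; ring
  rw [e, Complex.norm_exp_I_mul_ofReal_sub_one, norm_mul, Real.norm_eq_abs, Real.norm_eq_abs,
    show 2 * Real.pi * t / 2 = Real.pi * t by ring,
    Real.abs_sin_eq_sin_abs_of_abs_le_pi (by
      rw [abs_mul, abs_of_pos Real.pi_pos]; nlinarith [Real.pi_pos]),
    abs_mul, abs_of_pos Real.pi_pos]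
  have h1 := Real.mul_le_sin (x := Real.pi * |t|) (by positivity)
    (by nlinarith [Real.pi_pos])
  have h2 : 2 / Real.pi * (Real.pi * |t|) = 2 * |t| := by
    field_simp
  rw [h2] at h1
  rw [abs_two]
  linarith

theorem norm_exp_two_pi_I_mul (t : ℝ) : ‖Complex.exp (2 * Real.pi * Complex.I * t)‖ = 1 := by
  have e : (2 * Real.pi * Complex.I * t : ℂ) = ((2 * Real.pi * t : ℝ) : ℂ) * Complex.I := by
    push_cast; ring
  rw [e, Complex.norm_exp_ofReal_mul_I]

theorem mem_arc_iff {θ : ℝ} {z : ℂ} :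
    z ∈ arc θ ↔ ∃ t : ℝ, |t| ≤ θ ∧ z = Complex.exp (2 * Real.pi * Complex.I * t) := by
  simp [arc, abs_le, and_assoc]

theorem norm_eq_one_of_mem_arc {θ : ℝ} {z : ℂ} (hz : z ∈ arc θ) : ‖z‖ = 1 := by
  obtain ⟨t, -, rfl⟩ := mem_arc_iff.1 hz
  exact norm_exp_two_pi_I_mul t

theorem mem_arc_half_of_norm_eq_one {z : ℂ} (hz : ‖z‖ = 1) : z ∈ arc (1 / 2) := by
  refine mem_arc_iff.2 ⟨z.arg / (2 * Real.pi), ?_, ?_⟩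
  · rw [abs_div, abs_of_pos Real.two_pi_pos, div_le_iff₀ Real.two_pi_pos]
    linarith [Complex.abs_arg_le_pi z]
  · have h := Complex.norm_mul_exp_arg_mul_I z
    rw [hz] at h
    have hpi : (Real.pi : ℂ) ≠ 0 := by exact_mod_cast Real.pi_ne_zero
    have e : (2 * Real.pi * Complex.I * ((z.arg / (2 * Real.pi) : ℝ) : ℂ) : ℂ)
        = z.arg * Complex.I := by
      push_cast
      field_simp
    rw [e]
    simpa using h.symm

theorem measurableSet_arc (θ : ℝ) : MeasurableSet (arc θ) := by
  have : arc θ = (fun t : ℝ => Complex.exp (2 * Real.pi * Complex.I * t)) '' Icc (-θ) θ := by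
    ext z
    simp only [arc, mem_ofPred_eq, mem_image, mem_Icc, and_assoc]
    refine exists_congr fun t => ?_
    rw [eq_comm (a := z)]
  rw [this]
  exact (isCompact_Icc.image (by fun_prop)).measurableSet

/-- At `z = e^{2πit}` the geometric average has modulus at most `1 / (2m|t|)`. -/
theorem norm_eval_averagePoly_exp_mul_le {m : ℕ} (hm : 1 ≤ m) {t : ℝ} (ht : |t| ≤ 1 / 2) :
    ‖(averagePoly m).eval (Complex.exp (2 * Real.pi * Complex.I * t))‖ * (2 * m * |t|) ≤ 1 := by
  have h1 := norm_eval_averagePoly_mul_le hm (norm_exp_two_pi_I_mul t)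
  have h2 := four_mul_abs_le_norm_exp_sub_one ht
  have h3 : ‖(averagePoly m).eval (Complex.exp (2 * Real.pi * Complex.I * t))‖ * (m * (4 * |t|))
      ≤ 2 := le_trans (by gcongr) h1
  linarith

/-- The superlevel sets of the geometric average inside an arc are contained in smaller arcs. -/
theorem mem_arc_of_le_norm_eval_averagePoly {m : ℕ} (hm : 1 ≤ m) {θ s : ℝ} (hθ : θ ≤ 1 / 2)
    (hs : 0 < s) {z : ℂ} (hz : z ∈ arc θ) (hsz : s ≤ ‖(averagePoly m).eval z‖ ^ 2) :
    z ∈ arc (min θ (1 / (2 * m * √s))) := by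
  obtain ⟨t, ht, rfl⟩ := mem_arc_iff.1 hz
  refine mem_arc_iff.2 ⟨t, le_min ht ?_, rfl⟩
  have hm' : (1 : ℝ) ≤ m := by exact_mod_cast hm
  have h1 := norm_eval_averagePoly_exp_mul_le hm (ht.trans hθ)
  have h2 : √s ≤ ‖(averagePoly m).eval (Complex.exp (2 * Real.pi * Complex.I * t))‖ :=
    Real.sqrt_le_iff.2 ⟨norm_nonneg _, hsz⟩
  have h3 := Real.sqrt_pos.2 hs
  rw [le_div_iff₀ (by positivity)]
  calc |t| * (2 * m * √s) = √s * (2 * m * |t|) := by ring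
    _ ≤ _ := by gcongr
    _ ≤ 1 := h1

theorem one_sub_cos_pos {θ : ℝ} (hθ : θ ∈ Ioo (0 : ℝ) (1 / 2)) : 0 < 1 - Real.cos θ := by
  have h := Real.cos_lt_cos_of_nonneg_of_le_pi le_rfl
    (by linarith [hθ.2, Real.pi_gt_three] : θ ≤ Real.pi) hθ.1
  rw [Real.cos_zero] at h
  linarith

theorem norm_eval_averagePoly_sq_le_of_notMem_arc {m : ℕ} (hm : 1 ≤ m) {θ : ℝ}
    (hθ : θ ∈ Ioo (0 : ℝ) (1 / 2)) {z : ℂ} (hz : ‖z‖ = 1) (hzθ : z ∉ arc θ) :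
    ‖(averagePoly m).eval z‖ ^ 2 ≤ 1 / ((1 - Real.cos θ) * m ^ 2) := by
  obtain ⟨t, ht, rfl⟩ := mem_arc_iff.1 (mem_arc_half_of_norm_eq_one hz)
  have hlt : θ < |t| := by
    by_contra hle
    exact hzθ (mem_arc_iff.2 ⟨t, not_lt.1 hle, rfl⟩)
  have hm' : (1 : ℝ) ≤ m := by exact_mod_cast hm
  have hc := one_sub_cos_pos hθ
  have h1 := norm_eval_averagePoly_exp_mul_le hm ht
  set a := ‖(averagePoly m).eval (Complex.exp (2 * Real.pi * Complex.I * t))‖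
  have ha : 0 ≤ a := norm_nonneg _
  have h2 : a * (2 * m * θ) ≤ 1 := le_trans (by gcongr) h1
  have h3 : (a * (2 * m * θ)) ^ 2 ≤ 1 :=
    pow_le_one₀ (mul_nonneg ha (mul_nonneg (by positivity) hθ.1.le)) h2
  rw [le_div_iff₀ (by positivity)]
  -- `1 - cos θ ≤ θ² / 2`, which is far below the `4 θ²` available
  have h4 := Real.one_sub_sq_div_two_le_cos (x := θ)
  calc a ^ 2 * ((1 - Real.cos θ) * m ^ 2) ≤ a ^ 2 * ((4 * θ ^ 2) * m ^ 2) := by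
        gcongr
        nlinarith [sq_nonneg θ]
    _ = (a * (2 * m * θ)) ^ 2 := by ring
    _ ≤ 1 := h3

/-! ### Integrals of geometric averages against a measure with a power-law arc condition -/

theorem setIntegral_rpow_neg_half {α : ℝ} (hα : α < 2) :
    IntegrableOn (fun s : ℝ => s ^ (-(α / 2))) (Ioc 0 1) ∧
      ∫ s in Ioc (0 : ℝ) 1, s ^ (-(α / 2)) = 2 / (2 - α) := by
  have h1 : -1 < -(α / 2) := by linarith
  refine ⟨(intervalIntegrable_iff_integrableOn_Ioc_of_le zero_le_one).1
    (intervalIntegral.intervalIntegrable_rpow' h1), ?_⟩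
  rw [← intervalIntegral.integral_of_le zero_le_one, integral_rpow (Or.inl h1),
    Real.zero_rpow (by linarith), Real.one_rpow]
  rw [sub_zero, show -(α / 2) + 1 = (2 - α) / 2 by ring, one_div_div]

/-- If `ν(S_γ) ≤ A γ^α` for small `γ`, the mean square of the geometric average over `S_θ` is
`O(m^{-α})`. By the layer-cake formula it is the integral over `s ∈ (0, 1]` of
`ν {z ∈ S_θ : s ≤ |p(z)|²} ≤ A (2m√s)^{-α}`. -/
theorem setIntegral_arc_norm_eval_averagePoly_sq_le (ν : Measure ℂ) [IsFiniteMeasure ν]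
    {A α θ : ℝ} (hα : α ∈ Ioo (0 : ℝ) 2) (hθ : θ ∈ Ioo (0 : ℝ) (1 / 2)) (hA : 0 ≤ A)
    (hν : ∀ γ ∈ Ioc (0 : ℝ) θ, ν.real (arc γ) ≤ A * γ ^ α) {m : ℕ} (hm : 1 ≤ m) :
    ∫ z in arc θ, ‖(averagePoly m).eval z‖ ^ 2 ∂ν
      ≤ A * (2 / (2 - α) * (2 * m : ℝ) ^ (-α)) := by
  have hm' : (1 : ℝ) ≤ m := by exact_mod_cast hm
  set h : ℂ → ℝ := fun z => ‖(averagePoly m).eval z‖ ^ 2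
  have hcont : Continuous h := by fun_prop
  have hle1 : ∀ z ∈ arc θ, h z ≤ 1 := fun z hz =>
    pow_le_one₀ (norm_nonneg _) (norm_eval_averagePoly_le_one m (norm_eq_one_of_mem_arc hz))
  have hae : ∀ᵐ z ∂ν.restrict (arc θ), h z ≤ 1 :=
    (ae_restrict_iff' (measurableSet_arc θ)).2 (Filter.Eventually.of_forall hle1)
  have hint : Integrable h (ν.restrict (arc θ)) := by
    refine Integrable.of_bound hcont.aestronglyMeasurable 1 ?_
    filter_upwards [hae] with z hz
    rwa [Real.norm_of_nonneg (sq_nonneg _)]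
  obtain ⟨hI, hIv⟩ := setIntegral_rpow_neg_half hα.2
  rw [hint.integral_eq_integral_Ioc_meas_le
    (Filter.Eventually.of_forall fun z => sq_nonneg _) hae]
  have hpt : ∀ s ∈ Ioc (0 : ℝ) 1, (ν.restrict (arc θ)).real {z | s ≤ h z}
      ≤ A * (2 * m : ℝ) ^ (-α) * s ^ (-(α / 2)) := by
    rintro s ⟨hs, -⟩
    rw [measureReal_restrict_apply (measurableSet_le measurable_const hcont.measurable)]
    have hr : 0 < 1 / (2 * m * √s) := by
      have := Real.sqrt_pos.2 hs
      positivity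
    have hsub : {z | s ≤ h z} ∩ arc θ ⊆ arc (min θ (1 / (2 * m * √s))) := fun z hz =>
      mem_arc_of_le_norm_eval_averagePoly hm hθ.2.le hs hz.2 hz.1
    calc ν.real ({z | s ≤ h z} ∩ arc θ) ≤ ν.real (arc (min θ (1 / (2 * m * √s)))) :=
          measureReal_mono hsub
      _ ≤ A * (min θ (1 / (2 * m * √s))) ^ α := hν _ ⟨lt_min hθ.1 hr, min_le_left _ _⟩
      _ ≤ A * (1 / (2 * m * √s)) ^ α := by
          gcongr
          · exact (lt_min hθ.1 hr).le
          · exact hα.1.le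
          · exact min_le_right _ _
      _ = A * (2 * m : ℝ) ^ (-α) * s ^ (-(α / 2)) := by
          rw [one_div, Real.inv_rpow (by positivity), ← Real.rpow_neg (by positivity),
            Real.mul_rpow (by positivity) (Real.sqrt_nonneg _), Real.sqrt_eq_rpow,
            ← Real.rpow_mul hs.le, mul_assoc]
          congr 3
          ring
  refine (integral_mono_of_nonneg (Filter.Eventually.of_forall fun s => measureReal_nonneg)
    (hI.const_mul _)
    ((ae_restrict_iff' measurableSet_Ioc).2 (Filter.Eventually.of_forall hpt))).trans ?_
  rw [integral_const_mul, hIv]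
  exact le_of_eq (by ring)

/-- The layer-cake constant `2^{1-α} / (2 - α)` is dominated by `C(α)`. -/
theorem two_div_mul_two_rpow_le_constAlpha {α : ℝ} (hα : α ∈ Ioo (0 : ℝ) 2) :
    2 / (2 - α) * (2 : ℝ) ^ (-α) ≤ constAlpha α := by
  have h2 : 0 < 2 - α := by linarith [hα.2]
  have hp : (0 : ℝ) < 2 ^ (-α) := by positivity
  have hp1 : (2 : ℝ) ^ (-α) ≤ 1 :=
    Real.rpow_le_one_of_one_le_of_nonpos one_le_two (by linarith [hα.1])
  unfold constAlpha
  split_ifs with h h'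
  · have h3 : 0 < 1 - α := by linarith
    have h4 : 2 / (2 - α) ≤ 2 := by rw [div_le_iff₀ h2]; linarith
    have h5 : 4 ≤ (4 - 3 * α) / (1 - α) := by rw [le_div_iff₀ h3]; linarith [hα.1]
    nlinarith
  · subst h'
    have : (2 : ℝ) / (2 - 1) = 2 := by norm_num
    rw [this]
    linarith
  · have h3 : 0 < α - 1 := by
      rcases lt_or_eq_of_le (not_lt.1 h) with h0 | h0
      · linarith
      · exact absurd h0.symm h'
    have h4 : 2 / (2 - α) ≤ 3 / ((α - 1) * (2 - α)) := by
      rw [div_le_div_iff₀ h2 (mul_pos h3 h2)]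
      nlinarith [hα.2, mul_pos h3 h2]
    have h5 : 0 < 2 / (2 - α) := by positivity
    nlinarith

variable {H : Type*} [NormedAddCommGroup H] [InnerProductSpace ℂ H] [CompleteSpace H]

/-- The mean ergodic rate splits into the part of the spectral measure off the arc `S_θ`, of order
`m⁻²`, and the part on it, controlled by the layer-cake bound. -/
theorem norm_average_sq_le_add {U : H →L[ℂ] H} (hU : U ∈ unitary (H →L[ℂ] H)) (f : H)
    {α κ θ : ℝ} (hα : α ∈ Ioo (0 : ℝ) 2) (hκ : 0 ≤ κ) (hθ : θ ∈ Ioo (0 : ℝ) (1 / 2))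
    (hf : ∀ γ ∈ Ioc (0 : ℝ) θ,
      (spectralMeasure U (isStarNormal_of_mem_unitary hU) f).real (arc γ)
        ≤ κ * (spectralMeasure U (isStarNormal_of_mem_unitary hU) f).real (arc θ) * γ ^ α)
    {m : ℕ} (hm : 1 ≤ m) :
    ‖Polynomial.aeval U (averagePoly m) f‖ ^ 2
      ≤ κ * constAlpha α * (m : ℝ) ^ (-α)
          * (spectralMeasure U (isStarNormal_of_mem_unitary hU) f).real (arc θ)
        + 1 / ((1 - Real.cos θ) * m ^ 2)
          * (spectralMeasure U (isStarNormal_of_mem_unitary hU) f).real (arc θ)ᶜ := by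
  have hm' : (1 : ℝ) ≤ m := by exact_mod_cast hm
  rw [← integral_norm_eval_sq_spectralMeasure hU]
  set ν := spectralMeasure U (isStarNormal_of_mem_unitary hU) f
  have hfin : IsFiniteMeasure ν := isFiniteMeasure_spectralMeasure hU f
  have hone : ∀ᵐ z ∂ν, ‖z‖ = 1 := ae_norm_eq_one_spectralMeasure hU f
  have hcont : Continuous fun z : ℂ => ‖(averagePoly m).eval z‖ ^ 2 := by fun_prop
  have hint : Integrable (fun z : ℂ => ‖(averagePoly m).eval z‖ ^ 2) ν := by
    refine Integrable.of_bound hcont.aestronglyMeasurable 1 ?_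
    filter_upwards [hone] with z hz
    rw [Real.norm_of_nonneg (sq_nonneg _)]
    exact pow_le_one₀ (norm_nonneg _) (norm_eval_averagePoly_le_one m hz)
  rw [← integral_add_compl (measurableSet_arc θ) hint]
  refine add_le_add ?_ ?_
  · refine (setIntegral_arc_norm_eval_averagePoly_sq_le ν hα hθ
      (mul_nonneg hκ measureReal_nonneg) hf hm).trans ?_
    rw [Real.mul_rpow two_pos.le (by positivity)]
    have hA : 0 ≤ κ * ν.real (arc θ) * (m : ℝ) ^ (-α) := by positivity
    calc κ * ν.real (arc θ) * (2 / (2 - α) * (2 ^ (-α) * (m : ℝ) ^ (-α)))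
        = κ * ν.real (arc θ) * (m : ℝ) ^ (-α) * (2 / (2 - α) * 2 ^ (-α)) := by ring
      _ ≤ κ * ν.real (arc θ) * (m : ℝ) ^ (-α) * constAlpha α :=
          mul_le_mul_of_nonneg_left (two_div_mul_two_rpow_le_constAlpha hα) hA
      _ = _ := by ring
  · have hle : ∫ z in (arc θ)ᶜ, ‖(averagePoly m).eval z‖ ^ 2 ∂ν
        ≤ ∫ _z in (arc θ)ᶜ, 1 / ((1 - Real.cos θ) * m ^ 2) ∂ν := by
      refine setIntegral_mono_ae_restrict hint.integrableOn (integrable_const _) ?_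
      filter_upwards [ae_restrict_of_ae hone, ae_restrict_mem (measurableSet_arc θ).compl]
        with z hz hzθ
      exact norm_eval_averagePoly_sq_le_of_notMem_arc hm hθ hz hzθ
    refine hle.trans (le_of_eq ?_)
    rw [setIntegral_const, smul_eq_mul, mul_comm]

theorem measureReal_arc_add_compl {U : H →L[ℂ] H} (hU : U ∈ unitary (H →L[ℂ] H)) (f : H) (θ : ℝ) :
    (spectralMeasure U (isStarNormal_of_mem_unitary hU) f).real (arc θ)
      + (spectralMeasure U (isStarNormal_of_mem_unitary hU) f).real (arc θ)ᶜ = ‖f‖ ^ 2 := by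
  have hfin := isFiniteMeasure_spectralMeasure hU f
  have h := integral_norm_eval_sq_spectralMeasure hU f 1
  rw [measureReal_add_measureReal_compl (measurableSet_arc θ)]
  simpa using h

/-- Mean ergodic theorem with rate `m^{-α}`. -/
theorem norm_average_sq_le {U : H →L[ℂ] H} (hU : U ∈ unitary (H →L[ℂ] H)) (f : H)
    {α κ θ : ℝ} (hα : α ∈ Ioo (0 : ℝ) 2) (hκ : 0 ≤ κ) (hθ : θ ∈ Ioo (0 : ℝ) (1 / 2))
    (hf : ∀ γ ∈ Ioc (0 : ℝ) θ,
      (spectralMeasure U (isStarNormal_of_mem_unitary hU) f).real (arc γ)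
        ≤ κ * (spectralMeasure U (isStarNormal_of_mem_unitary hU) f).real (arc θ) * γ ^ α)
    {m : ℕ} (hm : 1 ≤ m) :
    ‖Polynomial.aeval U (averagePoly m) f‖ ^ 2 ≤ constC α κ θ / (m : ℝ) ^ α * ‖f‖ ^ 2 := by
  have hm' : (1 : ℝ) ≤ m := by exact_mod_cast hm
  have hc := one_sub_cos_pos hθ
  refine (norm_average_sq_le_add hU f hα hκ hθ hf hm).trans ?_
  rw [← measureReal_arc_add_compl hU f θ, mul_add,
    div_eq_mul_inv (constC α κ θ), ← Real.rpow_neg (by positivity)]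
  have hp : 0 ≤ (m : ℝ) ^ (-α) := by positivity
  have h1 : κ * constAlpha α ≤ constC α κ θ := le_max_right _ _
  have h2 : 1 / ((1 - Real.cos θ) * m ^ 2) ≤ constC α κ θ * (m : ℝ) ^ (-α) := by
    have h3 : ((m : ℝ) ^ 2)⁻¹ ≤ (m : ℝ) ^ (-α) := by
      rw [← Real.rpow_natCast, ← Real.rpow_neg (by positivity)]
      exact Real.rpow_le_rpow_of_exponent_le hm' (by push_cast; linarith [hα.2])
    calc 1 / ((1 - Real.cos θ) * m ^ 2) = 1 / (1 - Real.cos θ) * ((m : ℝ) ^ 2)⁻¹ := by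
          rw [one_div, mul_inv, one_div]
      _ ≤ 2 / (1 - Real.cos θ) * (m : ℝ) ^ (-α) := by gcongr; norm_num
      _ ≤ constC α κ θ * (m : ℝ) ^ (-α) := by
          gcongr
          exact le_max_left _ _
  gcongr

/-- If the spectral measure vanishes near `1`, the mean ergodic rate is `m⁻²`. -/
theorem norm_average_sq_le_of_gap {U : H →L[ℂ] H} (hU : U ∈ unitary (H →L[ℂ] H)) (f : H)
    {θ : ℝ} (hθ : θ ∈ Ioo (0 : ℝ) (1 / 2))
    (hf : (spectralMeasure U (isStarNormal_of_mem_unitary hU) f).real (arc θ) = 0)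
    {m : ℕ} (hm : 1 ≤ m) :
    ‖Polynomial.aeval U (averagePoly m) f‖ ^ 2 ≤ 1 / ((1 - Real.cos θ) * m ^ 2) * ‖f‖ ^ 2 := by
  have hfin := isFiniteMeasure_spectralMeasure hU f
  have h := norm_average_sq_le_add hU f (α := 1) (κ := 0) (by norm_num) le_rfl hθ
    (fun γ hγ => by
      have hsub : arc γ ⊆ arc θ := fun z hz => by
        obtain ⟨t, ht, rfl⟩ := mem_arc_iff.1 hz
        exact mem_arc_iff.2 ⟨t, ht.trans hγ.2, rfl⟩
      have := (measureReal_mono hsub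
        (μ := spectralMeasure U (isStarNormal_of_mem_unitary hU) f)).trans hf.le
      simpa using this) hm
  rw [← measureReal_arc_add_compl hU f θ, hf, zero_add]
  simpa [hf] using h


/-! ### Perturbation of the EDMD matrix -/

section Perturbation

variable {n : Type*} [Fintype n] [DecidableEq n]

theorem frobenius_norm_sq_eq_sum (A : Matrix n n ℝ) : ‖A‖ ^ 2 = ∑ i, ∑ j, A i j ^ 2 := by
  rw [Matrix.frobenius_norm_def, ← Real.sqrt_eq_rpow, Real.sq_sqrt (by positivity)]
  simp

/-- An invertible matrix stays invertible under a perturbation of relative size less than one. The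
norm of the identity need not be `1`, so the Neumann series is replaced by injectivity. -/
theorem isUnit_of_norm_inv_mul_norm_sub_lt_one {C C' : Matrix n n ℝ} (hC : IsUnit C)
    (h : ‖C⁻¹‖ * ‖C - C'‖ < 1) : IsUnit C' := by
  have hdet := (Matrix.isUnit_iff_isUnit_det C).1 hC
  have h1 : ‖C⁻¹ * (C - C')‖ < 1 := (norm_mul_le _ _).trans_lt h
  have h2 : C' = C * (1 - C⁻¹ * (C - C')) := by
    rw [mul_sub, mul_one, ← mul_assoc, Matrix.mul_nonsing_inv _ hdet, one_mul, sub_sub_cancel]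
  rw [h2]
  exact hC.mul (isUnit_one_sub_of_norm_lt_one h1)

/-- Relative error bound for the solution `C⁻¹ D` of the linear system `C X = D`. -/
theorem norm_inv_mul_sub_inv_mul_le {C C' D D' : Matrix n n ℝ} (hC : IsUnit C) (hC' : IsUnit C') :
    ‖C⁻¹ * D - C'⁻¹ * D'‖ * (1 - ‖C⁻¹‖ * ‖C - C'‖)
      ≤ ‖C⁻¹‖ * (‖D - D'‖ + ‖C - C'‖ * (‖C⁻¹‖ * ‖D‖)) := by
  have hdet := (Matrix.isUnit_iff_isUnit_det C).1 hC
  have hdet' := (Matrix.isUnit_iff_isUnit_det C').1 hC'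
  set R := C⁻¹ * D - C'⁻¹ * D' with hR
  -- `R` solves a fixed-point equation in which only `C` is inverted
  have hfix : R = C⁻¹ * ((D - D') - (C - C') * (C⁻¹ * D) + (C - C') * R) := by
    have e1 : C * (C⁻¹ * D) = D := by rw [← mul_assoc, Matrix.mul_nonsing_inv _ hdet, one_mul]
    have e2 : C' * (C'⁻¹ * D') = D' := by
      rw [← mul_assoc, Matrix.mul_nonsing_inv _ hdet', one_mul]
    have e3 : (D - D') - (C - C') * (C⁻¹ * D) + (C - C') * R = C * R := by
      have : C' * R = C' * (C⁻¹ * D) - D' := by rw [hR, mul_sub, e2]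
      rw [sub_mul, sub_mul, e1, this]
      abel
    rw [e3, ← mul_assoc, Matrix.nonsing_inv_mul _ hdet, one_mul]
  have hle : ‖R‖ ≤ ‖C⁻¹‖ * (‖D - D'‖ + ‖C - C'‖ * (‖C⁻¹‖ * ‖D‖) + ‖C - C'‖ * ‖R‖) := by
    conv_lhs => rw [hfix]
    refine (norm_mul_le _ _).trans ?_
    gcongr
    refine (norm_add_le _ _).trans ?_
    gcongr
    · refine (norm_sub_le _ _).trans ?_
      gcongr
      refine (norm_mul_le _ _).trans ?_
      gcongr
      exact norm_mul_le _ _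
    · exact norm_mul_le _ _
  nlinarith

/-- The tolerances `u / ‖C⁻¹‖` for `C` and `3u / (2‖C⁻¹‖)` for `D`, with
`u (‖C⁻¹‖ ‖D‖ + ε + 3/2) = ε`, guarantee an error of at most `ε` in `C⁻¹ D`. -/
theorem isUnit_and_norm_inv_mul_sub_le {C C' D D' : Matrix n n ℝ} (hC : IsUnit C)
    {ε u : ℝ} (hu : 0 < u) (hε : 0 < ε)
    (hεu : u * (‖C⁻¹‖ * ‖D‖ + ε + 3 / 2) = ε)
    (h1 : ‖C⁻¹‖ * ‖C - C'‖ < u) (h2 : ‖C⁻¹‖ * ‖D - D'‖ < 3 / 2 * u) :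
    IsUnit C' ∧ ‖C⁻¹ * D - C'⁻¹ * D'‖ ≤ ε := by
  have hx : 0 ≤ ‖C⁻¹‖ * ‖D‖ := by positivity
  have hu1 : u < 1 := by nlinarith
  have hC' := isUnit_of_norm_inv_mul_norm_sub_lt_one hC (h1.trans hu1)
  refine ⟨hC', ?_⟩
  have h := norm_inv_mul_sub_inv_mul_le (D := D) (D' := D') hC hC'
  set r := ‖C⁻¹ * D - C'⁻¹ * D'‖
  have hr : 0 ≤ r := norm_nonneg _
  have h3 : ‖C⁻¹‖ * (‖D - D'‖ + ‖C - C'‖ * (‖C⁻¹‖ * ‖D‖))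
      ≤ 3 / 2 * u + u * (‖C⁻¹‖ * ‖D‖) := by
    rw [mul_add, ← mul_assoc]
    gcongr
  have h4 : r * (1 - u) ≤ r * (1 - ‖C⁻¹‖ * ‖C - C'‖) := by gcongr
  have h5 : r * (1 - u) ≤ ε * (1 - u) := by nlinarith
  exact le_of_mul_le_mul_right h5 (by linarith)

/-- The numerical inequality behind the constant `M`, with `13/9 = 1 + (3/2)⁻²`. The ratio `3/2` of
the two tolerances is close to the optimal `(x + ε)^{1/3}` in the critical range `x ≈ 1.3`,
`ε ≈ 2`. -/
theorem sq_mul_le_of_lt_two {x ε : ℝ} (hx : 0 ≤ x) (hε : ε ∈ Ioo (0 : ℝ) 2) :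
    (x + ε + 3 / 2) ^ 2 * (13 / 9) * x ^ 2 ≤ 8 * (1 + x ^ 2) ^ 2 := by
  -- `(17/40)²` just exceeds `13/72`, and the quadratic left at `ε = 2` still has no real root
  have h0 : (x + ε + 3 / 2) * x * (17 / 40) ≤ 1 + x ^ 2 := by
    have : (x + ε + 3 / 2) * x ≤ (x + 7 / 2) * x :=
      mul_le_mul_of_nonneg_right (by linarith [hε.2]) hx
    nlinarith [sq_nonneg (23 * x - 119 / 4)]
  have h1 : ((x + ε + 3 / 2) * x * (17 / 40)) ^ 2 ≤ (1 + x ^ 2) ^ 2 := by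
    have := hε.1
    gcongr
  nlinarith [sq_nonneg ((x + ε + 3 / 2) * x)]

end Perturbation

/-! ### Ergodic averages of observables -/

section Averages

variable {S : Type*} [MeasurableSpace S] {μ : Measure S}

theorem koopman_pow_toLp (T : S → S) (hT : MeasurePreserving T μ μ) {q : S → ℂ}
    (hq : MemLp q 2 μ) (k : ℕ) :
    (koopman T hT ^ k) (hq.toLp q) = (hq.comp_measurePreserving (hT.iterate k)).toLp _ := by
  induction k with
  | zero => rfl
  | succ k ih =>
    rw [pow_succ']
    change koopman T hT ((koopman T hT ^ k) (hq.toLp q)) = _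
    rw [ih]
    rfl

theorem aeval_averagePoly_koopman_ae_eq (T : S → S) (hT : MeasurePreserving T μ μ) {q : S → ℂ}
    (hq : MemLp q 2 μ) (m : ℕ) :
    ((Polynomial.aeval (koopman T hT) (averagePoly m) (hq.toLp q) : Lp ℂ 2 μ) : S → ℂ)
      =ᵐ[μ] fun x => 1 / (m : ℂ) * ∑ k ∈ Finset.range m, q (T^[k] x) := by
  have e : Polynomial.aeval (koopman T hT) (averagePoly m) (hq.toLp q)
      = (1 / (m : ℂ)) • ∑ k ∈ Finset.range m,
        (hq.comp_measurePreserving (hT.iterate k)).toLp (q ∘ T^[k]) := by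
    simp only [averagePoly, map_mul, Polynomial.aeval_C, map_sum, map_pow, Polynomial.aeval_X,
      Algebra.algebraMap_eq_smul_one, smul_mul_assoc, one_mul, ← koopman_pow_toLp T hT hq]
    rw [smul_apply, sum_apply]
  rw [e]
  refine (Lp.coeFn_smul _ _).trans ?_
  have h1 : ∀ᵐ x ∂μ, ∀ k, ((hq.comp_measurePreserving (hT.iterate k)).toLp (q ∘ T^[k]) : S → ℂ) x
      = q (T^[k] x) := ae_all_iff.2 fun k => MemLp.coeFn_toLp _
  filter_upwards [h1, Lp.coeFn_finsetSum (Finset.range m) fun k =>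
    (hq.comp_measurePreserving (hT.iterate k)).toLp (q ∘ T^[k])] with x hx hs
  rw [Pi.smul_apply, hs, smul_eq_mul, Finset.sum_apply]
  simp [hx]

variable [IsProbabilityMeasure μ]

/-- `Q` subtracts the mean. -/
theorem projQ_toLp {q : S → ℝ} (hq : MemLp (fun x => (q x : ℂ)) 2 μ) :
    projQ μ (hq.toLp _)
      = (hq.sub (memLp_const (((∫ x, q x ∂μ : ℝ) : ℂ)))).toLp _ := by
  have hone : ‖oneL2 μ‖ = 1 := by
    simp [oneL2, Lp.norm_const]
  have hin : ⟪oneL2 μ, hq.toLp _⟫_ℂ = ((∫ x, q x ∂μ : ℝ) : ℂ) := by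
    rw [L2.inner_def]
    refine Eq.trans (integral_congr_ae ?_) integral_complex_ofReal
    filter_upwards [Lp.coeFn_const (p := 2) (μ := μ) (1 : ℂ), hq.coeFn_toLp] with x h1 h2
    rw [oneL2, h1, h2]
    simp
  rw [projQ, Submodule.starProjection_orthogonal_val, MemLp.toLp_sub hq (memLp_const _),
    Submodule.starProjection_unit_singleton ℂ hone, hin, MemLp.toLp_const, oneL2]
  congr 1
  have h := (Lp.constₗ (E := ℂ) 2 μ ℂ).map_smul ((∫ x, q x ∂μ : ℝ) : ℂ) 1
  simpa using h.symm

/-- The mean-square deviation of the time average of `q` from its space average is the squared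
norm of the ergodic average of `Q q`. -/
theorem norm_average_projQ_sq (T : S → S) (hT : MeasurePreserving T μ μ) {q : S → ℝ}
    (hq : MemLp (fun x => (q x : ℂ)) 2 μ) {m : ℕ} (hm : 1 ≤ m) :
    ‖Polynomial.aeval (koopman T hT) (averagePoly m) (projQ μ (hq.toLp _))‖ ^ 2
      = ∫ x, (1 / (m : ℝ) * ∑ k ∈ Finset.range m, q (T^[k] x) - ∫ y, q y ∂μ) ^ 2 ∂μ := by
  have hm' : (m : ℂ) ≠ 0 := by exact_mod_cast (by omega : m ≠ 0)
  rw [projQ_toLp hq]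
  set F := Polynomial.aeval (koopman T hT) (averagePoly m)
    ((hq.sub (memLp_const (((∫ x, q x ∂μ : ℝ) : ℂ)))).toLp _) with hF
  have h0 : ‖F‖ ^ 2 = RCLike.re ⟪F, F⟫_ℂ := norm_sq_eq_re_inner (𝕜 := ℂ) F
  rw [h0, L2.inner_def, ← integral_re (L2.integrable_inner F F)]
  refine integral_congr_ae ?_
  filter_upwards [aeval_averagePoly_koopman_ae_eq T hT
    (hq.sub (memLp_const (((∫ x, q x ∂μ : ℝ) : ℂ)))) m] with x hx
  have e : (F : S → ℂ) x
      = ((1 / (m : ℝ) * ∑ k ∈ Finset.range m, q (T^[k] x) - ∫ y, q y ∂μ : ℝ) : ℂ) := by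
    rw [hF, hx]
    push_cast
    simp only [Pi.sub_apply, Finset.sum_sub_distrib, Finset.sum_const, Finset.card_range,
      nsmul_eq_mul]
    field_simp
  rw [e]
  simp only [inner_self_eq_norm_sq_to_K, Complex.norm_real, Real.norm_eq_abs]
  norm_cast
  exact sq_abs _

/-- `‖Q q‖²` is the variance of `q`: an ergodic average of length one is `q` itself. -/
theorem norm_projQ_sq {q : S → ℝ} (hq : MemLp (fun x => (q x : ℂ)) 2 μ) :
    ‖projQ μ (hq.toLp _)‖ ^ 2 = ∫ x, q x ^ 2 ∂μ - (∫ x, q x ∂μ) ^ 2 := by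
  have h := norm_average_projQ_sq id (MeasurePreserving.id μ) hq le_rfl
  have e : Polynomial.aeval (koopman id (MeasurePreserving.id μ)) (averagePoly 1) = 1 := by
    simp [averagePoly]
  rw [e] at h
  change ‖projQ μ (hq.toLp _)‖ ^ 2 = _ at h
  have hq' : MemLp q 2 μ := by simpa using hq.re
  have hv := variance_eq_sub hq'
  rw [variance_eq_integral hq'.aestronglyMeasurable.aemeasurable] at hv
  simp only [Pi.pow_apply] at hv
  rw [← hv]
  simpa using h

end Averages


/-! ### Mean-square and tail bounds for empirical matrices -/

section Empirical

theorem empMass_apply {S : Type*} {N : ℕ} (ψ : Fin N → S → ℝ) (m : ℕ) (x : ℕ → S) (i j : Fin N) :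
    empMass ψ m x i j = 1 / (m : ℝ) * ∑ k ∈ Finset.range m, ψ i (x k) * ψ j (x k) := by
  simp [empMass, dataMatrix, Matrix.mul_apply, Finset.sum_range]

theorem empStiff_apply {S : Type*} {N : ℕ} (ψ : Fin N → S → ℝ) (m : ℕ) (x : ℕ → S) (i j : Fin N) :
    empStiff ψ m x i j = 1 / (m : ℝ) * ∑ k ∈ Finset.range m, ψ i (x k) * ψ j (x (k + 1)) := by
  simp [empStiff, dataMatrix, Matrix.mul_apply, Finset.sum_range]

variable {S : Type*} [MeasurableSpace S] {μ : Measure S} {N : ℕ}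

/-- The matrix of space averages of the observables `q i j`. -/
noncomputable def spaceAverage (μ : Measure S) (q : Fin N → Fin N → S → ℝ) :
    Matrix (Fin N) (Fin N) ℝ :=
  Matrix.of fun i j => ∫ x, q i j x ∂μ

/-- The matrix of time averages of the observables `q i j` along the first `m` points of the orbit
of `x`. -/
noncomputable def timeAverage (T : S → S) (m : ℕ) (q : Fin N → Fin N → S → ℝ) (x : S) :
    Matrix (Fin N) (Fin N) ℝ :=
  Matrix.of fun i j => 1 / (m : ℝ) * ∑ k ∈ Finset.range m, q i j (T^[k] x)

theorem measurable_norm_timeAverage_sub_sq {T : S → S} (hT : Measurable T)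
    {q : Fin N → Fin N → S → ℝ} (hq : ∀ i j, Measurable (q i j)) (m : ℕ)
    (A : Matrix (Fin N) (Fin N) ℝ) : Measurable fun x => ‖timeAverage T m q x - A‖ ^ 2 := by
  simp only [frobenius_norm_sq_eq_sum, Matrix.sub_apply, timeAverage, Matrix.of_apply]
  have (k : ℕ) := hT.iterate k
  fun_prop

variable [IsProbabilityMeasure μ]

theorem sum_norm_projQ_sq {q : Fin N → Fin N → S → ℝ}
    (hq : ∀ i j, MemLp (fun x => (q i j x : ℂ)) 2 μ) :
    ∑ i, ∑ j, ‖projQ μ ((hq i j).toLp _)‖ ^ 2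
      = ∫ x, ∑ i, ∑ j, q i j x ^ 2 ∂μ - ‖spaceAverage μ q‖ ^ 2 := by
  have hint (i j) : Integrable (fun x => q i j x ^ 2) μ := by
    have : MemLp (q i j) 2 μ := by simpa using (hq i j).re
    exact this.integrable_sq
  rw [integral_finsetSum _ fun i _ => integrable_finsetSum _ fun j _ => hint i j,
    frobenius_norm_sq_eq_sum, ← Finset.sum_sub_distrib]
  refine Finset.sum_congr rfl fun i _ => ?_
  rw [integral_finsetSum _ fun j _ => hint i j, ← Finset.sum_sub_distrib]
  exact Finset.sum_congr rfl fun j _ => norm_projQ_sq (hq i j)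

/-- A rate `c` in the mean ergodic theorem for the observables `Q q_{ij}` bounds the mean-square
error of the matrix of time averages; Chebyshev's inequality turns this into a tail bound. -/
theorem measureReal_le_norm_timeAverage_sub (T : S → S) (hT : MeasurePreserving T μ μ)
    {q : Fin N → Fin N → S → ℝ} (hq : ∀ i j, MemLp (fun x => (q i j x : ℂ)) 2 μ)
    {m : ℕ} (hm : 1 ≤ m) {c : ℝ}
    (hc : ∀ i j, ‖Polynomial.aeval (koopman T hT) (averagePoly m) (projQ μ ((hq i j).toLp _))‖ ^ 2
      ≤ c * ‖projQ μ ((hq i j).toLp _)‖ ^ 2) {δ : ℝ} (hδ : 0 < δ) :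
    μ.real {x | δ ^ 2 ≤ ‖timeAverage T m q x - spaceAverage μ q‖ ^ 2}
      ≤ c * (∫ x, ∑ i, ∑ j, q i j x ^ 2 ∂μ - ‖spaceAverage μ q‖ ^ 2) / δ ^ 2 := by
  have hmem (i j) : MemLp (q i j) 2 μ := by simpa using (hq i j).re
  have hint (i j) : Integrable (fun x =>
      (1 / (m : ℝ) * ∑ k ∈ Finset.range m, q i j (T^[k] x) - ∫ y, q i j y ∂μ) ^ 2) μ := by
    refine MemLp.integrable_sq (MemLp.sub (MemLp.const_mul ?_ _) (memLp_const _))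
    exact memLp_finsetSum _ fun k _ => (hmem i j).comp_measurePreserving (hT.iterate k)
  have e : (fun x => ‖timeAverage T m q x - spaceAverage μ q‖ ^ 2) = fun x => ∑ i, ∑ j,
      (1 / (m : ℝ) * ∑ k ∈ Finset.range m, q i j (T^[k] x) - ∫ y, q i j y ∂μ) ^ 2 := by
    funext x
    rw [frobenius_norm_sq_eq_sum]
    rfl
  have hI : Integrable (fun x => ‖timeAverage T m q x - spaceAverage μ q‖ ^ 2) μ := by
    rw [e]
    exact integrable_finsetSum _ fun i _ => integrable_finsetSum _ fun j _ => hint i j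
  have hval : ∫ x, ‖timeAverage T m q x - spaceAverage μ q‖ ^ 2 ∂μ
      ≤ c * (∫ x, ∑ i, ∑ j, q i j x ^ 2 ∂μ - ‖spaceAverage μ q‖ ^ 2) := by
    rw [e, integral_finsetSum _ fun i _ => integrable_finsetSum _ fun j _ => hint i j,
      ← sum_norm_projQ_sq hq, Finset.mul_sum]
    refine Finset.sum_le_sum fun i _ => ?_
    rw [integral_finsetSum _ fun j _ => hint i j, Finset.mul_sum]
    refine Finset.sum_le_sum fun j _ => ?_
    rw [← norm_average_projQ_sq T hT (hq i j) hm]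
    exact hc i j
  rw [le_div_iff₀ (by positivity), mul_comm]
  exact (mul_meas_ge_le_integral_of_nonneg (Filter.Eventually.of_forall fun x => sq_nonneg _)
    hI _).trans hval

end Empirical

/-! ### The dictionary -/

section Dictionary

theorem phi_mul_phi {S : Type*} {N : ℕ} (ψ : Fin N → S → ℝ) (x y : S) :
    phi ψ y * phi ψ x = ∑ i, ∑ j, (ψ i x * ψ j y) ^ 2 := by
  simp only [phi, mul_comm (∑ j, ψ j y ^ 2), Finset.sum_mul_sum, mul_pow]

variable {S : Type*} [MeasurableSpace S] {μ : Measure S} {N : ℕ} {ψ : Fin N → S → ℝ}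

variable [IsProbabilityMeasure μ]

/-- `μ`-linear independence makes the mass matrix positive definite, hence invertible. -/
theorem isUnit_massMatrix (hψ : ∀ i, Measurable (ψ i)) (hφ : MemLp (phi ψ) 2 μ)
    (hlin : AELinearIndependent μ ψ) : IsUnit (massMatrix μ ψ) := by
  have hint (i j) : Integrable (fun x => ψ i x * ψ j x) μ := by
    have h := (memLp_mul_comp hψ hφ (MeasurePreserving.id μ) i j).re
    have h' : MemLp (fun x => ψ i x * ψ j x) 2 μ := by simpa using h
    exact h'.integrable (by norm_num)
  have e (v : Fin N → ℝ) : (fun x => (∑ j, v j * ψ j x) ^ 2)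
      = fun x => ∑ i, ∑ j, v i * v j * (ψ i x * ψ j x) := by
    funext x
    rw [sq, Finset.sum_mul_sum]
    exact Finset.sum_congr rfl fun i _ => Finset.sum_congr rfl fun j _ => by ring
  rw [← Matrix.mulVec_injective_iff_isUnit]
  refine (injective_iff_map_eq_zero (massMatrix μ ψ).mulVecLin).2 fun v hv => ?_
  rw [Matrix.mulVecLin_apply] at hv
  have hq : ∫ x, (∑ j, v j * ψ j x) ^ 2 ∂μ = v ⬝ᵥ (massMatrix μ ψ).mulVec v := by
    rw [e v]
    rw [integral_finsetSum _ fun i _ => integrable_finsetSum _ fun j _ => (hint i j).const_mul _]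
    simp only [dotProduct, Matrix.mulVec, Finset.mul_sum]
    refine Finset.sum_congr rfl fun i _ => ?_
    rw [integral_finsetSum _ fun j _ => (hint i j).const_mul _]
    refine Finset.sum_congr rfl fun j _ => ?_
    rw [integral_const_mul, massMatrix, Matrix.of_apply]
    ring
  rw [hv, dotProduct_zero] at hq
  have hI : Integrable (fun x => (∑ j, v j * ψ j x) ^ 2) μ := by
    rw [e v]
    exact integrable_finsetSum _ fun i _ => integrable_finsetSum _ fun j _ =>
      (hint i j).const_mul _
  have h0 := (integral_eq_zero_iff_of_nonneg (fun x => sq_nonneg _) hI).1 hq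
  funext j
  refine hlin v ?_ j
  filter_upwards [h0] with x hx
  simpa using hx

theorem energyZero_nonneg (hψ : ∀ i, Measurable (ψ i)) (hφ : MemLp (phi ψ) 2 μ) :
    0 ≤ energyZero μ ψ := by
  have h := sum_norm_projQ_sq (memLp_mul_comp hψ hφ (MeasurePreserving.id μ))
  simp only [energyZero, sq (phi ψ _), phi_mul_phi]
  exact (Finset.sum_nonneg fun i _ => Finset.sum_nonneg fun j _ => sq_nonneg _).trans_eq h

/-- A common rate `c` in the mean ergodic theorem for all members of `family` bounds the
probability that the EDMD matrix deviates by more than `ε`. -/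
theorem measureReal_edmd_error_le (T : S → S) (hT : MeasurePreserving T μ μ)
    (hψ : ∀ i, Measurable (ψ i)) (hφ : MemLp (phi ψ) 2 μ) (hlin : AELinearIndependent μ ψ)
    (hC : stiffMatrix μ T ψ ≠ 0)
    {Ω : Type*} [MeasurableSpace Ω] (P : Measure Ω) [IsProbabilityMeasure P]
    (X : ℕ → Ω → S) (hX0 : HasLaw (X 0) μ P) (hX : ∀ n, ∀ᵐ ω ∂P, X (n + 1) ω = T (X n ω))
    {m : ℕ} (hm : 1 ≤ m) {ε : ℝ} (hε : ε ∈ Ioo (0 : ℝ) 2) {c : ℝ} (hc0 : 0 ≤ c)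
    (hc : ∀ f ∈ family ψ hψ hφ T hT,
      ‖Polynomial.aeval (koopman T hT) (averagePoly m) f‖ ^ 2 ≤ c * ‖f‖ ^ 2) :
    P.real {ω | ¬ IsUnit (empMass ψ m fun k => X k ω) ∨
        ε < ‖(massMatrix μ ψ)⁻¹ * stiffMatrix μ T ψ
          - (empMass ψ m fun k => X k ω)⁻¹ * empStiff ψ m fun k => X k ω‖}
      ≤ c * constM μ T ψ / ε ^ 2 := by
  have hunit := isUnit_massMatrix hψ hφ hlin
  set a := ‖(massMatrix μ ψ)⁻¹‖
  set b := ‖stiffMatrix μ T ψ‖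
  have hb : 0 < b := norm_pos_iff.2 hC
  have ha : 0 < a := by
    -- a vanishing inverse forces the matrix ring, and with it `C₊`, to be zero
    refine norm_pos_iff.2 fun h0 => hC ?_
    have h1 := Matrix.mul_nonsing_inv _ ((Matrix.isUnit_iff_isUnit_det _).1 hunit)
    rw [h0, mul_zero] at h1
    rw [← mul_one (stiffMatrix μ T ψ), ← h1, mul_zero]
  have hε0 := hε.1
  obtain ⟨u, hu, hεu⟩ : ∃ u, 0 < u ∧ u * (a * b + ε + 3 / 2) = ε :=
    ⟨ε / (a * b + ε + 3 / 2), by positivity, by field_simp⟩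
  -- `id` makes `q₀` match the statement of `memLp_mul_comp` for the identity map
  set q₀ : Fin N → Fin N → S → ℝ := fun i j x => ψ i x * ψ j (id x)
  set q₁ : Fin N → Fin N → S → ℝ := fun i j x => ψ i x * ψ j (T x)
  have hmeas₀ (i j) : Measurable (q₀ i j) := (hψ i).mul (hψ j)
  have hmeas₁ (i j) : Measurable (q₁ i j) := (hψ i).mul ((hψ j).comp hT.measurable)
  set B₀ : Set S := {x | (u / a) ^ 2 ≤ ‖timeAverage T m q₀ x - spaceAverage μ q₀‖ ^ 2}
  set B₁ : Set S :=
    {x | (3 / 2 * u / a) ^ 2 ≤ ‖timeAverage T m q₁ x - spaceAverage μ q₁‖ ^ 2}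
  have hB₀m : MeasurableSet B₀ := measurableSet_le measurable_const
    (measurable_norm_timeAverage_sub_sq hT.measurable hmeas₀ m _)
  have hB₁m : MeasurableSet B₁ := measurableSet_le measurable_const
    (measurable_norm_timeAverage_sub_sq hT.measurable hmeas₁ m _)
  have hμ₀ : μ.real B₀ ≤ c * energyZero μ ψ / (u / a) ^ 2 := by
    have h := measureReal_le_norm_timeAverage_sub T hT
      (memLp_mul_comp hψ hφ (MeasurePreserving.id μ)) hm
      (fun i j => hc _ (Or.inl ⟨i, j, rfl⟩)) (δ := u / a) (by positivity)
    simp only [energyZero, sq (phi ψ _), phi_mul_phi]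
    exact h
  have hμ₁ : μ.real B₁ ≤ c * energyPlus μ T ψ / (3 / 2 * u / a) ^ 2 := by
    have h := measureReal_le_norm_timeAverage_sub T hT (memLp_mul_comp hψ hφ hT) hm
      (fun i j => hc _ (Or.inr ⟨i, j, rfl⟩)) (δ := 3 / 2 * u / a) (by positivity)
    simp only [energyPlus, phi_mul_phi]
    exact h
  -- the trajectory is almost surely the orbit of its initial point
  have horb : ∀ᵐ ω ∂P, ∀ k, X k ω = T^[k] (X 0 ω) := by
    filter_upwards [ae_all_iff.2 hX] with ω hω k
    induction k with
    | zero => rfl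
    | succ k ih => rw [hω, ih, Function.iterate_succ_apply']
  have hsub : ({ω | ¬ IsUnit (empMass ψ m fun k => X k ω) ∨
      ε < ‖(massMatrix μ ψ)⁻¹ * stiffMatrix μ T ψ
        - (empMass ψ m fun k => X k ω)⁻¹ * empStiff ψ m fun k => X k ω‖} : Set Ω)
      ≤ᵐ[P] {ω | X 0 ω ∈ B₀ ∪ B₁} := by
    filter_upwards [horb] with ω hω hbad
    by_contra hgood
    have hgood' : X 0 ω ∉ B₀ ∧ X 0 ω ∉ B₁ := not_or.1 hgood
    have hE₀ : (empMass ψ m fun k => X k ω) = timeAverage T m q₀ (X 0 ω) := by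
      ext i j
      rw [empMass_apply, timeAverage, Matrix.of_apply]
      refine congrArg _ (Finset.sum_congr rfl fun k _ => ?_)
      rw [hω k]
      rfl
    have hE₁ : (empStiff ψ m fun k => X k ω) = timeAverage T m q₁ (X 0 ω) := by
      ext i j
      rw [empStiff_apply, timeAverage, Matrix.of_apply]
      refine congrArg _ (Finset.sum_congr rfl fun k _ => ?_)
      rw [hω (k + 1), hω k, Function.iterate_succ_apply']
    have h₀ : ‖timeAverage T m q₀ (X 0 ω) - massMatrix μ ψ‖ < u / a :=
      lt_of_pow_lt_pow_left₀ 2 (by positivity) (not_le.1 hgood'.1)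
    have h₁ : ‖timeAverage T m q₁ (X 0 ω) - stiffMatrix μ T ψ‖ < 3 / 2 * u / a :=
      lt_of_pow_lt_pow_left₀ 2 (by positivity) (not_le.1 hgood'.2)
    rw [norm_sub_rev, lt_div_iff₀' ha] at h₀ h₁
    obtain ⟨h₂, h₃⟩ := isUnit_and_norm_inv_mul_sub_le hunit hu hε0 hεu h₀ h₁
    rw [← hE₀, ← hE₁] at h₃
    rw [← hE₀] at h₂
    rcases hbad with h | h
    · exact h h₂
    · exact absurd h₃ (not_le.2 h)
  calc P.real _ ≤ P.real {ω | X 0 ω ∈ B₀ ∪ B₁} :=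
        ENNReal.toReal_mono (measure_ne_top _ _) (measure_mono_ae hsub)
    _ = μ.real (B₀ ∪ B₁) := hX0.measureReal_eq (p := fun x => x ∈ B₀ ∪ B₁) (hB₀m.union hB₁m)
    _ ≤ μ.real B₀ + μ.real B₁ := measureReal_union_le _ _
    _ ≤ c * energyZero μ ψ / (u / a) ^ 2 + c * energyPlus μ T ψ / (3 / 2 * u / a) ^ 2 :=
        add_le_add hμ₀ hμ₁
    _ ≤ c * max (energyZero μ ψ) (energyPlus μ T ψ) / (u / a) ^ 2
        + c * max (energyZero μ ψ) (energyPlus μ T ψ) / (3 / 2 * u / a) ^ 2 := by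
        gcongr
        · exact le_max_left _ _
        · exact le_max_right _ _
    _ = c * max (energyZero μ ψ) (energyPlus μ T ψ) / ε ^ 2 / b ^ 2
        * ((a * b + ε + 3 / 2) ^ 2 * (13 / 9) * (a * b) ^ 2) := by
        have hsum : u = ε / (a * b + ε + 3 / 2) := by
          rw [eq_div_iff (by positivity)]; exact hεu
        rw [hsum]
        field_simp
        ring
    _ ≤ c * max (energyZero μ ψ) (energyPlus μ T ψ) / ε ^ 2 / b ^ 2
        * (8 * (1 + (a * b) ^ 2) ^ 2) := by
        have hmax : 0 ≤ max (energyZero μ ψ) (energyPlus μ T ψ) :=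
          (energyZero_nonneg hψ hφ).trans (le_max_left _ _)
        exact mul_le_mul_of_nonneg_left (sq_mul_le_of_lt_two (by positivity) hε) (by positivity)
    _ = c * constM μ T ψ / ε ^ 2 := by
        rw [constM]
        ring

end Dictionary

end Edmd

theorem mainTheorem4
    {S : Type*} [TopologicalSpace S] [PolishSpace S] [MeasurableSpace S] [BorelSpace S]
    (μ : Measure S) [IsProbabilityMeasure μ]
    -- the measure-preserving map, with unitary Koopman operator
    (T : S → S) (hT : MeasurePreserving T μ μ)
    (hK : Edmd.koopman T hT ∈ unitary (Lp ℂ 2 μ →L[ℂ] Lp ℂ 2 μ))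
    -- the dictionary
    {N : ℕ} (ψ : Fin N → S → ℝ) (hψ : ∀ i, Continuous (ψ i))
    (hφ : MemLp (Edmd.phi ψ) 2 μ) (hlin : Edmd.AELinearIndependent μ ψ)
    (hC : Edmd.stiffMatrix μ T ψ ≠ 0)
    -- the sampled trajectory
    {Ω : Type*} [MeasurableSpace Ω] (P : Measure Ω) [IsProbabilityMeasure P]
    (X : ℕ → Ω → S) (hX0 : HasLaw (X 0) μ P)
    (hX : ∀ n, ∀ᵐ ω ∂P, X (n + 1) ω = T (X n ω))
    -- the spectral condition
    (α κ θ : ℝ) (hα : α ∈ Ioo (0 : ℝ) 2) (hκ : 0 ≤ κ) (hθ : θ ∈ Ioo (0 : ℝ) (1 / 2))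
    (hF : ∀ f ∈ Edmd.family ψ (fun i => (hψ i).measurable) hφ T hT, ∀ γ ∈ Ioc (0 : ℝ) θ,
      (Edmd.spectralMeasure (Edmd.koopman T hT) (isStarNormal_of_mem_unitary hK) f).real
          (Edmd.arc γ)
        ≤ κ * (Edmd.spectralMeasure (Edmd.koopman T hT) (isStarNormal_of_mem_unitary hK) f).real
          (Edmd.arc θ) * γ ^ α)
    (m : ℕ) (hm : 1 ≤ m) (ε : ℝ) (hε : ε ∈ Ioo (0 : ℝ) 2) :
    P.real {ω | ¬ IsUnit (Edmd.empMass ψ m fun k => X k ω) ∨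
        ε < ‖(Edmd.massMatrix μ ψ)⁻¹ * Edmd.stiffMatrix μ T ψ
          - (Edmd.empMass ψ m fun k => X k ω)⁻¹ * Edmd.empStiff ψ m fun k => X k ω‖}
      ≤ Edmd.constC α κ θ * Edmd.constM μ T ψ / ((m : ℝ) ^ α * ε ^ 2) ∧
    (κ = 0 →
      P.real {ω | ¬ IsUnit (Edmd.empMass ψ m fun k => X k ω) ∨
          ε < ‖(Edmd.massMatrix μ ψ)⁻¹ * Edmd.stiffMatrix μ T ψ
            - (Edmd.empMass ψ m fun k => X k ω)⁻¹ * Edmd.empStiff ψ m fun k => X k ω‖}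
        ≤ Edmd.constM μ T ψ / ((1 - Real.cos θ) * (m : ℝ) ^ 2 * ε ^ 2)) := by

  have hcos := Edmd.one_sub_cos_pos hθ
  have hm' : (0 : ℝ) < m := by exact_mod_cast hm
  refine ⟨?_, fun hκ0 => ?_⟩
  · have hc : 0 ≤ Edmd.constC α κ θ / (m : ℝ) ^ α :=
      div_nonneg (le_max_of_le_left (by positivity)) (by positivity)
    refine (Edmd.measureReal_edmd_error_le T hT (fun i => (hψ i).measurable) hφ hlin hC
      P X hX0 hX hm hε hc
      fun f hf => Edmd.norm_average_sq_le hK f hα hκ hθ (hF f hf) hm).trans (le_of_eq ?_)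
    rw [div_mul_eq_mul_div, div_div]
  · have hc : 0 ≤ 1 / ((1 - Real.cos θ) * (m : ℝ) ^ 2) := by positivity
    refine (Edmd.measureReal_edmd_error_le T hT (fun i => (hψ i).measurable) hφ hlin hC
      P X hX0 hX hm hε hc
      fun f hf => Edmd.norm_average_sq_le_of_gap hK f hθ ?_ hm).trans (le_of_eq ?_)
    · refine le_antisymm ?_ measureReal_nonneg
      simpa [hκ0] using hF f hf θ ⟨hθ.1, le_rfl⟩
    · rw [one_div_mul_eq_div, div_div]
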